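/- Let $G$ be a connected complex reductive group with maximal torus $T^{\mathbb C}$ and Borel subgroup $B$, let $\Delta_+$ be the positive roots, $W$ the Weyl group with length function $l$, strong Bruhat order $\le$, covering relation $\gtrdot$ and longest element $w_0$, and let $r_\beta\in W$ be the reflection in a root $\beta$. Let $H_T^*(pt)$ be the polynomial ring over $\mathbb Z$ in the simple roots, and let $H_T^*(G/B)$ be modelled as the $H_T^*(pt)$-algebra of all lists $p=(p|_w)_{w\in W}$ of elements of $H_T^*(pt)$ such that $p|_w-p|_{r_\beta w}$ is a multiple of $\beta$ for all $w\in W$ and all roots $\beta$. For each $w\in W$ there is a unique class $S_w$ (the equivariant Schubert class) that is homogeneous of degree $l(w)$ (each root having degree $1$), satisfies $S_w|_v=0$ for all $v\ne w$ with $l(v)\le l(w)$, and satisfies $S_w|_w=\prod_{\beta\in\Delta_+,\ r_\beta w<w}\beta$; and the $S_w$ form a basis of $H_T^*(G/B)$ over $H_T^*(pt)$. For $w,v,u\in W$ let $$c_{wvu}=\int_{G/B}S_wS_vS_u\in\mathbb Z$$ be the ordinary intersection number, i.e. the image under $H_T^*(pt)\to H^*(pt)=\mathbb Z$ (all roots $\mapsto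 0$) of the coefficient of the point class $S_{w_0}$ in the expansion of $S_wS_vS_u$. Let $r=r_\alpha$ be the reflection in a simple root $\alpha$, and let $u,v,w\in W$ satisfy $ur>u$, $vr>v$, $wr>w$ and $$l(u)+l(v)+l(w)+2=\dim_{\mathbb C}G/B=|\Delta_+|,$$ i.e. $l(w)+l(vr)+l(ur)=\dim_{\mathbb C}G/B$. Then $$c_{w,vr,ur}=c_{wr,vr,u}+c_{wr,v,ur}+\sum_{\beta\in\Delta_+,\ w'=wr_\beta\gtrdot w,\ w'\ne wr}\langle\alpha,\beta\rangle\,c_{w',v,ur},$$ where $\langle\alpha,\beta\rangle=(\alpha-r_\beta\alpha)/\beta\in\mathbb Z$. -/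

import Mathlib

noncomputable section

namespace FlagSchubert

variable {ι X Y : Type*} [AddCommGroup X] [AddCommGroup Y]

/-! ### The Weyl group of a root datum -/

section Weyl

variable {P : RootDatum ι X Y}

/-- The reflection `r_β` in the Weyl group, for a root `β` (given by its index). -/
abbrev refl (P : RootDatum ι X Y) (β : ι) : P.weylGroup :=
  RootPairing.weylGroup.ofIdx P β

lemma smul_sub_mem_rootSpan (g : P.weylGroup) (x : X) : g • x - x ∈ P.rootSpan ℤ := by
  obtain ⟨g, hg⟩ := g
  induction hg using RootPairing.weylGroup.induction generalizing x with
  | mem i =>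
    change P.reflection i x - x ∈ _
    rw [P.reflection_apply, sub_sub_cancel_left, neg_mem_iff]
    exact Submodule.smul_mem _ _ (Submodule.subset_span ⟨i, rfl⟩)
  | one =>
    have h : (⟨1, one_mem _⟩ : P.weylGroup) • x = x := one_smul P.weylGroup x
    rw [h, sub_self]
    exact zero_mem _
  | mul g h hg hh ihg ihh =>
    rw [← Submonoid.mk_mul_mk _ g h hg hh, mul_smul,
      ← sub_add_sub_cancel _ ((⟨h, hh⟩ : P.weylGroup) • x)]
    exact add_mem (ihg _) (ihh _)

lemma weylGroupToPerm_injective [Finite ι] (P : RootDatum ι X Y) :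
    Function.Injective P.weylGroupToPerm := by
  have := Fintype.ofFinite ι
  rw [injective_iff_map_eq_one]
  intro g hg
  have key : ∀ x : X, g • x = x := by
    intro x
    rw [← sub_eq_zero]
    apply P.eq_zero_of_mem_rootSpan_of_rootForm_self_eq_zero (smul_sub_mem_rootSpan g x)
    rw [P.rootForm_apply_apply]
    refine Finset.sum_eq_zero fun j _ ↦ ?_
    have hj : P.toLinearMap (g • x) (P.coroot j) = P.toLinearMap x (P.coroot j) := by
      have h1 := RootPairing.Hom.coroot_coweightMap_apply P P (g.1.indexEquiv j) g.1.toHom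
      have h2 : g.1.indexEquiv j = j := congrArg (fun e : Equiv.Perm ι ↦ e j) hg
      rw [Equiv.symm_apply_apply, h2] at h1
      have h3 := LinearMap.congr_fun
        (RootPairing.Hom.weight_coweight_transpose_apply P P (P.coroot j) g.1.toHom) x
      rw [h1] at h3
      exact h3
    have hj' : P.coroot' j (g • x - x) = 0 := by
      rw [map_sub, sub_eq_zero]
      exact hj
    rw [hj', zero_mul]
  apply Subtype.ext
  apply RootPairing.Equiv.weightHom_injective P
  ext x
  exact key x

end Weyl

instance weylGroup_finite [Finite ι] (P : RootDatum ι X Y) : Finite P.weylGroup :=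
  Finite.of_injective _ (weylGroupToPerm_injective P)

/-! ### Length and (strong) Bruhat order on the Weyl group -/

section Bruhat

variable {P : RootDatum ι X Y} (b : P.Base)

/-- The length `l(w)`: the least number of factors in an expression of `w` as a product of simple
reflections. -/
def length (w : P.weylGroup) : ℕ :=
  sInf {n | ∃ s : List b.support, s.length = n ∧ (s.map fun α ↦ refl P α).prod = w}

/-- `x ≤ y` in the strong Bruhat order: `y` is reached from `x` by a chain of right
multiplications by reflections, each of which increases the length. -/
def BruhatLE (x y : P.weylGroup) : Prop :=
  Relation.ReflTransGen (fun x' y' ↦ (∃ β, y' = x' * refl P β) ∧ length b x' < length b y') x y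

/-- `x < y` in the strong Bruhat order. -/
def BruhatLT (x y : P.weylGroup) : Prop :=
  BruhatLE b x y ∧ x ≠ y

/-- `y ⋗ x`: the element `y` covers `x` in the strong Bruhat order. -/
def BruhatCovers (y x : P.weylGroup) : Prop :=
  BruhatLT b x y ∧ ¬ ∃ z, BruhatLT b x z ∧ BruhatLT b z y

/-- The longest element `w₀` of the Weyl group. -/
def longest [Finite ι] : P.weylGroup :=
  (Finite.exists_max (length b)).choose

lemma length_le_length_longest [Finite ι] (w : P.weylGroup) :
    length b w ≤ length b (longest b) :=
  (Finite.exists_max (length b)).choose_spec w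

/-- The complex dimension of `G/B`, which is the number of positive roots. -/
def flagDim : ℕ := Nat.card {β : ι // b.IsPos β}

end Bruhat

/-! ### Equivariant cohomology of `G/B` and its Schubert classes -/

section Cohomology

variable {P : RootDatum ι X Y} (b : P.Base)

/-- The base ring `H_T^*(pt)`: the polynomial ring over `ℤ` in the simple roots. -/
abbrev BaseRing : Type _ := MvPolynomial b.support ℤ

/-- A root `β = ∑ n_α α` (sum over the simple roots `α`) as an element of `H_T^*(pt)`. -/
def rootPoly (β : ι) : BaseRing b :=
  ∑ α : b.support,
    MvPolynomial.C (b.toWeightBasisInt.repr (P.rootSpanMem ℤ β) α) * MvPolynomial.X α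

/-- The ring `H_T^*(G/B)` as the ring of lists `(p|_w)_{w ∈ W}` of elements of `H_T^*(pt)` that
satisfy the GKM conditions: `p|_w - p|_{r_β w}` is a multiple of `β`, for each `w` and each
root `β`. -/
def equivariantCohomology : Subalgebra (BaseRing b) (P.weylGroup → BaseRing b) where
  carrier := {p | ∀ (w : P.weylGroup) (β : ι), rootPoly b β ∣ p w - p (refl P β * w)}
  mul_mem' {p q} hp hq w β := by
    have h : (p * q) w - (p * q) (refl P β * w) =
        (p w - p (refl P β * w)) * q w + p (refl P β * w) * (q w - q (refl P β * w)) := by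
      simp only [Pi.mul_apply]
      ring
    rw [h]
    exact dvd_add ((hp w β).mul_right _) ((hq w β).mul_left _)
  add_mem' {p q} hp hq w β := by
    have h : (p + q) w - (p + q) (refl P β * w) =
        (p w - p (refl P β * w)) + (q w - q (refl P β * w)) := by
      simp only [Pi.add_apply]
      ring
    rw [h]
    exact dvd_add (hp w β) (hq w β)
  algebraMap_mem' c w β := by simp

/-- The property that characterizes the equivariant Schubert class `S_w` of `X_w`. -/
structure IsSchubertClass (w : P.weylGroup) (p : P.weylGroup → BaseRing b) : Prop where
  /-- `p` is a class, i.e. satisfies the GKM conditions. -/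
  mem : p ∈ equivariantCohomology b
  /-- `p` is homogeneous of (polynomial) degree `l(w)`, i.e. of cohomological degree `2 l(w)`. -/
  homogeneous : ∀ v, (p v).IsHomogeneous (length b w)
  /-- `p` vanishes at each `v ≠ w` that is not longer than `w`. -/
  vanishes : ∀ v, length b v ≤ length b w → v ≠ w → p v = 0
  /-- `p|_w` is the product of the positive roots `β` with `r_β w < w`. -/
  apply_self : p w = ∏ᶠ (β : ι) (_ : b.IsPos β ∧ BruhatLT b (refl P β * w) w), rootPoly b β

/-- The equivariant Schubert class `S_w`. -/
def schubertClass (w : P.weylGroup) : P.weylGroup → BaseRing b :=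
  Classical.epsilon (IsSchubertClass b w)

/-- The coefficients `c_u ∈ H_T^*(pt)` of a class `p = ∑_u c_u S_u` in the Schubert basis. -/
def schubertCoeff (p : P.weylGroup → BaseRing b) : P.weylGroup → BaseRing b :=
  Classical.epsilon fun c ↦ p = ∑ᶠ u, c u • schubertClass b u

/-- The integral over `G/B` in ordinary cohomology of (the image of) a class `p`. The class
`S_{w₀}` is that of a point and has integral `1`, the other Schubert classes have integral `0`,
and the forgetful map to ordinary cohomology sends each root in `H_T^*(pt)` to `0`. -/
def ordinaryIntegral [Finite ι] (p : P.weylGroup → BaseRing b) : ℤ :=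
  MvPolynomial.constantCoeff (schubertCoeff b p (longest b))

/-- The ordinary intersection number `c_{wvu} = ∫_{G/B} S_w S_v S_u`. -/
def intersectionNumber [Finite ι] (w v u : P.weylGroup) : ℤ :=
  ordinaryIntegral b (schubertClass b w * schubertClass b v * schubertClass b u)

end Cohomology

end FlagSchubert

end

/-! Fix a simple root α and r = r_α. The element r acts on H_T^*(G/B) from the right by p ↦ (v ↦
p|_{vr}), an algebra map over H_T^*(pt) (`reflHom`). If wr > w, then S_w is invariant, while S_{wr}
goes to S_{wr} + c S_w. Here c is the degree-one class v ↦ vα (`chernClass`), which goes to −c.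
Expanding, one finds that S_w S_{vr} S_{ur} − S_{wr} S_{vr} S_u + S_{wr} S_v S_{ur} + c S_w S_v
S_{ur} is invariant. But the ordinary integral changes sign under r (`integralHom_reflHom`), so this
class has integral 0. The Chevalley formula c S_w = (wα) S_w − ∑ ⟨α,β⟩ S_{wr_β}
(`chernClass_mul_schubert`) evaluates the last term: the equivariant coefficient wα dies, and the
summand β = α, with ⟨α,α⟩ = 2, reverses the sign of c_{wr,v,ur}. This is the recurrence.

The facts on Schubert classes rest on one rigidity principle (`eq_zero_of_vanishes`): a homogeneous
class of degree d that vanishes at all elements of length at most d is 0. The GKM conditions make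
the value at the next element divisible by more than d pairwise non-associated primes, its
inversions. Rigidity gives uniqueness and the Chevalley formula. Existence comes from divided
differences, starting at the class supported at the longest element. -/

set_option linter.unusedSectionVars false

noncomputable section

namespace FlagSchubert

variable {ι X Y : Type*} [AddCommGroup X] [AddCommGroup Y]

/-! ### The Weyl group as a permutation group of the roots -/

section WeylAction

variable {P : RootDatum ι X Y}

/-- The action of the Weyl group on the indices of the roots. -/
def act (w : P.weylGroup) : Equiv.Perm ι := P.weylGroupToPerm w

/-- The index of the root opposite to the root with index `i`. -/
abbrev opp (P : RootDatum ι X Y) (i : ι) : ι := P.reflectionPerm i i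

lemma act_mul (v w : P.weylGroup) (i : ι) : act (v * w) i = act v (act w i) := by
  rw [act, map_mul, Equiv.Perm.mul_apply, act, act]

lemma act_one (i : ι) : act (1 : P.weylGroup) i = i := by
  rw [act, map_one, Equiv.Perm.one_apply]

@[simp]
lemma act_inv_act (w : P.weylGroup) (i : ι) : act w⁻¹ (act w i) = i := by
  rw [← act_mul, inv_mul_cancel, act_one]

@[simp]
lemma act_act_inv (w : P.weylGroup) (i : ι) : act w (act w⁻¹ i) = i := by
  rw [← act_mul, mul_inv_cancel, act_one]

lemma act_refl (i j : ι) : act (refl P i) j = P.reflectionPerm i j := rfl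

lemma root_act (w : P.weylGroup) (i : ι) : P.root (act w i) = w • P.root i :=
  (P.weylGroup_apply_root w i).symm

lemma root_act_refl (i j : ι) :
    P.root (act (refl P i) j) = P.root j - P.pairing j i • P.root i := by
  rw [act_refl, P.root_reflectionPerm, P.reflection_apply_root]

lemma root_opp (i : ι) : P.root (opp P i) = -P.root i := by
  simp

lemma opp_opp (i : ι) : opp P (opp P i) = i :=
  P.root.injective (by simp only [root_opp, neg_neg])

lemma act_opp (w : P.weylGroup) (i : ι) : act w (opp P i) = opp P (act w i) :=
  P.root.injective (by rw [root_act, root_opp, root_opp, root_act, smul_neg])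

lemma act_refl_self (i : ι) : act (refl P i) i = opp P i := rfl

lemma refl_mul_self (i : ι) : refl P i * refl P i = 1 :=
  Subtype.ext (by
    change RootPairing.Equiv.reflection P i * RootPairing.Equiv.reflection P i = 1
    nth_rewrite 1 [← RootPairing.Equiv.reflection_inv P i]
    exact inv_mul_cancel _)

lemma refl_inv (i : ι) : (refl P i)⁻¹ = refl P i :=
  inv_eq_of_mul_eq_one_right (refl_mul_self i)

@[simp]
lemma refl_mul_refl_mul (i : ι) (w : P.weylGroup) : refl P i * (refl P i * w) = w := by
  rw [← mul_assoc, refl_mul_self, one_mul]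

@[simp]
lemma mul_refl_mul_refl (i : ι) (w : P.weylGroup) : w * refl P i * refl P i = w := by
  rw [mul_assoc, refl_mul_self, mul_one]

lemma weylGroup_induction {p : P.weylGroup → Prop} (one : p 1)
    (refl_mul : ∀ i w, p w → p (refl P i * w)) (w : P.weylGroup) : p w := by
  suffices ∀ v, p v → p (w * v) by simpa using this 1 one
  obtain ⟨w, hw⟩ := w
  induction hw using RootPairing.weylGroup.induction with
  | mem i => exact fun v hv ↦ refl_mul i v hv
  | one => intro v hv; exact (one_mul v).symm ▸ hv
  | mul g h hg hh ihg ihh =>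
    intro v hv
    rw [← Submonoid.mk_mul_mk _ g h hg hh, mul_assoc]
    exact ihg _ (ihh _ hv)

lemma pairing_act (w : P.weylGroup) (i j : ι) :
    P.pairing (act w i) (act w j) = P.pairing i j := by
  induction w using weylGroup_induction with
  | one => rw [act_one, act_one]
  | refl_mul k w ih =>
    rw [act_mul, act_mul, act_refl, act_refl, P.pairing_reflectionPerm, P.reflectionPerm_self, ih]

section Finite

variable [Finite ι]

lemma weylGroup_ext {v w : P.weylGroup} (h : ∀ i, act v i = act w i) : v = w :=
  weylGroupToPerm_injective P (Equiv.ext h)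

lemma refl_act (w : P.weylGroup) (i : ι) : refl P (act w i) = w * refl P i * w⁻¹ := by
  refine weylGroup_ext fun j ↦ P.root.injective ?_
  obtain ⟨j, rfl⟩ := (act w).surjective j
  rw [act_mul, act_mul, act_inv_act, root_act_refl, pairing_act, root_act w (act _ _),
    root_act_refl, smul_sub, root_act, root_act, smul_comm]

lemma refl_act_mul (w : P.weylGroup) (i : ι) : refl P (act w i) * w = w * refl P i := by
  rw [refl_act, inv_mul_cancel_right]

lemma mul_refl_act_inv (w : P.weylGroup) (i : ι) : w * refl P (act w⁻¹ i) = refl P i * w := by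
  rw [← refl_act_mul, act_act_inv]

lemma refl_opp (i : ι) : refl P (opp P i) = refl P i := by
  rw [← act_refl_self, refl_act, refl_mul_self, one_mul, refl_inv]

/-- Applying both reflections to the i-th root gives 2β_i = ⟨β_i,β_j⟩β_j, a linear dependence, and
the root system is reduced. -/
lemma eq_or_eq_opp_of_refl_eq [P.IsReduced] {i j : ι} (h : refl P i = refl P j) :
    i = j ∨ i = opp P j := by
  have h1 := root_act_refl (P := P) j i
  rw [← h, act_refl_self, root_opp] at h1
  have h2 : ¬ LinearIndependent ℤ ![P.root i, P.root j] := by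
    rw [LinearIndependent.pair_iff]
    intro h3
    have := (h3 2 (-P.pairing i j) (by rw [neg_smul, ← sub_eq_add_neg, two_smul, add_sub_assoc, ← h1, add_neg_cancel])).1
    exact two_ne_zero this
  rcases RootPairing.IsReduced.eq_or_eq_neg i j h2 with h3 | h3
  · exact Or.inl (P.root.injective h3)
  · exact Or.inr (P.root.injective (h3.trans (root_opp j).symm))

end Finite

end WeylAction

/-! ### Length, inversions, the longest element and Bruhat order -/

section Length

variable {P : RootDatum ι X Y} (b : P.Base)

lemma isPos_opp (i : ι) : b.IsPos (opp P i) ↔ ¬ b.IsPos i :=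
  RootPairing.Base.IsPos.neg_iff_not b i

variable [Finite ι]

lemma eq_of_refl_eq [P.IsReduced] {i j : ι} (hi : b.IsPos i) (hj : b.IsPos j)
    (h : refl P i = refl P j) : i = j := by
  rcases eq_or_eq_opp_of_refl_eq h with h | h
  · exact h
  · rw [h, isPos_opp] at hi
    exact absurd hj hi

/-- The product of the simple reflections in a word. -/
def wordProd (s : List b.support) : P.weylGroup := (s.map fun α ↦ refl P α).prod

lemma wordProd_cons (α : b.support) (s : List b.support) :
    wordProd b (α :: s) = refl P α * wordProd b s := by
  simp [wordProd]

lemma wordProd_append (s t : List b.support) :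
    wordProd b (s ++ t) = wordProd b s * wordProd b t := by
  simp [wordProd]

lemma wordProd_singleton (α : b.support) : wordProd b [α] = refl P α := by
  simp [wordProd]

lemma wordProd_nil : wordProd b [] = 1 := by
  simp [wordProd]

variable {b} in
/-- The strong exchange property. -/
lemma exists_wordProd_eq_mul_refl [P.IsReduced] (s : List b.support) {β : ι} (hβ : b.IsPos β)
    (h : ¬ b.IsPos (act (wordProd b s) β)) :
    ∃ t, t.length + 1 = s.length ∧ wordProd b t = wordProd b s * refl P β := by
  induction s with
  | nil =>
    rw [wordProd_nil, act_one] at h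
    exact absurd hβ h
  | cons α s ih =>
    rw [wordProd_cons, act_mul] at h
    by_cases h1 : b.IsPos (act (wordProd b s) β)
    · have h2 : act (wordProd b s) β = α := by
        by_contra h2
        exact h (h1.reflectionPerm α.2 h2)
      refine ⟨s, rfl, ?_⟩
      rw [wordProd_cons, mul_assoc, ← refl_act_mul, h2, refl_mul_refl_mul]
    · obtain ⟨t, ht, ht'⟩ := ih h1
      exact ⟨α :: t, by simp [ht], by rw [wordProd_cons, ht', wordProd_cons, mul_assoc]⟩

lemma exists_wordProd_eq_refl [P.IsReduced] (i : ι) : ∃ s, wordProd b s = refl P i := by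
  induction i using b.induction_reflect with
  | h₀ i h => rwa [refl_opp]
  | h₁ i hi => exact ⟨[⟨i, hi⟩], wordProd_singleton b _⟩
  | h₂ i j h hj =>
    obtain ⟨s, hs⟩ := h
    refine ⟨⟨j, hj⟩ :: (s ++ [⟨j, hj⟩]), ?_⟩
    rw [← act_refl, refl_act, refl_inv, wordProd_cons, wordProd_append, hs, wordProd_singleton,
      mul_assoc]

lemma exists_wordProd_eq [P.IsReduced] (w : P.weylGroup) : ∃ s, wordProd b s = w := by
  induction w using weylGroup_induction with
  | one => exact ⟨[], wordProd_nil b⟩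
  | refl_mul i w ih =>
    obtain ⟨s, hs⟩ := exists_wordProd_eq_refl b i
    obtain ⟨t, ht⟩ := ih
    exact ⟨s ++ t, by rw [wordProd_append, hs, ht]⟩

lemma length_wordProd_le (s : List b.support) : length b (wordProd b s) ≤ s.length :=
  Nat.sInf_le ⟨s, rfl, rfl⟩

variable [P.IsReduced]

/-- `length` is an `sInf` and would be 0 by default on an empty set; as the simple reflections
generate the group, the infimum is attained by a reduced word. -/
lemma exists_wordProd_eq_of_length (w : P.weylGroup) :
    ∃ s, s.length = length b w ∧ wordProd b s = w := by
  obtain ⟨s, hs⟩ := exists_wordProd_eq b w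
  exact Nat.sInf_mem (s := {n | ∃ s : List b.support, s.length = n ∧ wordProd b s = w})
    ⟨_, s, rfl, hs⟩

lemma length_one : length b (1 : P.weylGroup) = 0 := by
  have := length_wordProd_le b []
  rwa [wordProd_nil, List.length_nil, Nat.le_zero] at this

lemma eq_one_of_length_eq_zero {w : P.weylGroup} (h : length b w = 0) : w = 1 := by
  obtain ⟨s, hs, rfl⟩ := exists_wordProd_eq_of_length b w
  rw [h, List.length_eq_zero_iff] at hs
  rw [hs, wordProd_nil]

variable {b}

lemma length_mul_refl_lt {w : P.weylGroup} {β : ι} (hβ : b.IsPos β) (h : ¬ b.IsPos (act w β)) :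
    length b (w * refl P β) < length b w := by
  obtain ⟨s, hs, rfl⟩ := exists_wordProd_eq_of_length b w
  obtain ⟨t, ht, ht'⟩ := exists_wordProd_eq_mul_refl s hβ h
  have := length_wordProd_le b t
  rw [ht'] at this
  omega

lemma lt_length_mul_refl {w : P.weylGroup} {β : ι} (hβ : b.IsPos β) (h : b.IsPos (act w β)) :
    length b w < length b (w * refl P β) := by
  simpa using length_mul_refl_lt (w := w * refl P β) hβ
    (by rwa [act_mul, act_refl_self, act_opp, isPos_opp, not_not])

lemma length_mul_refl_lt_iff {w : P.weylGroup} {β : ι} (hβ : b.IsPos β) :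
    length b (w * refl P β) < length b w ↔ ¬ b.IsPos (act w β) :=
  ⟨fun h h' ↦ h.asymm (lt_length_mul_refl hβ h'), length_mul_refl_lt hβ⟩

lemma lt_length_mul_refl_iff {w : P.weylGroup} {β : ι} (hβ : b.IsPos β) :
    length b w < length b (w * refl P β) ↔ b.IsPos (act w β) :=
  ⟨fun h ↦ not_not.1 fun h' ↦ h.asymm (length_mul_refl_lt hβ h'), lt_length_mul_refl hβ⟩

lemma length_refl_mul_lt_iff {w : P.weylGroup} {β : ι} (hβ : b.IsPos β) :
    length b (refl P β * w) < length b w ↔ ¬ b.IsPos (act w⁻¹ β) := by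
  rw [← mul_refl_act_inv]
  by_cases h : b.IsPos (act w⁻¹ β)
  · rw [length_mul_refl_lt_iff h, act_act_inv]
    tauto
  · rw [← refl_opp, length_mul_refl_lt_iff ((isPos_opp b _).2 h), act_opp, act_act_inv, isPos_opp]
    tauto

lemma length_mul_simple_le (w : P.weylGroup) {α : ι} (hα : α ∈ b.support) :
    length b (w * refl P α) ≤ length b w + 1 := by
  obtain ⟨s, hs, rfl⟩ := exists_wordProd_eq_of_length b w
  have := length_wordProd_le b (s ++ [⟨α, hα⟩])
  rwa [wordProd_append, wordProd_singleton, List.length_append, hs] at this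

lemma length_mul_simple {w : P.weylGroup} {α : ι} (hα : α ∈ b.support) (h : b.IsPos (act w α)) :
    length b (w * refl P α) = length b w + 1 :=
  le_antisymm (length_mul_simple_le w hα)
    (lt_length_mul_refl (RootPairing.Base.isPos_of_mem_support hα) h)

open scoped Classical in
variable (b) in
/-- The inversions of `w⁻¹`: the positive roots `β` with `w⁻¹ β` negative. -/
def inversions (w : P.weylGroup) : Finset ι :=
  {β ∈ (Set.toFinite (Set.univ : Set ι)).toFinset | b.IsPos β ∧ ¬ b.IsPos (act w⁻¹ β)}

lemma mem_inversions {w : P.weylGroup} {β : ι} :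
    β ∈ inversions b w ↔ b.IsPos β ∧ ¬ b.IsPos (act w⁻¹ β) := by
  simp [inversions]

lemma notMem_inversions {w : P.weylGroup} {α : ι} (hα : b.IsPos α) :
    act w α ∉ inversions b w := by
  rw [mem_inversions, act_inv_act]
  tauto

open scoped Classical in
-- A simple reflection permutes the positive roots other than its own, so wα is the only sign that
-- changes.
lemma inversions_mul_simple {w : P.weylGroup} {α : ι} (hα : α ∈ b.support)
    (h : b.IsPos (act w α)) :
    inversions b (w * refl P α) = insert (act w α) (inversions b w) := by
  have hα' := RootPairing.Base.isPos_of_mem_support hα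
  ext β
  obtain ⟨β, rfl⟩ := (act w).surjective β
  rw [Finset.mem_insert, mem_inversions, mem_inversions, mul_inv_rev, act_mul, refl_inv,
    act_inv_act, EmbeddingLike.apply_eq_iff_eq]
  by_cases h1 : β = α
  · subst h1
    simp only [h, true_and, true_or, iff_true]
    rwa [act_refl_self, isPos_opp, not_not]
  · simp only [h1, false_or]
    refine and_congr_right fun hβ ↦ not_congr ⟨fun h2 ↦ ?_, fun h2 ↦ h2.reflectionPerm hα h1⟩
    by_contra h3
    have h4 : b.IsPos (opp P β) := (isPos_opp b _).2 h3
    by_cases h5 : opp P β = α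
    · rw [← opp_opp (P := P) β, h5, act_opp, isPos_opp] at hβ
      exact hβ h
    · have h6 := h4.reflectionPerm hα h5
      rw [← act_refl, act_opp, isPos_opp] at h6
      exact h6 h2

lemma exists_simple_length_lt {w : P.weylGroup} (hw : w ≠ 1) :
    ∃ α ∈ b.support, length b (w * refl P α) < length b w := by
  obtain ⟨s, hs, rfl⟩ := exists_wordProd_eq_of_length b w
  rcases List.eq_nil_or_concat s with rfl | ⟨t, α, rfl⟩
  · exact absurd (wordProd_nil b) hw
  · refine ⟨α, α.2, ?_⟩
    rw [List.concat_eq_append] at hs ⊢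
    rw [← hs, wordProd_append, wordProd_singleton, mul_refl_mul_refl, List.length_append]
    exact Nat.lt_succ_of_le (length_wordProd_le b t)

lemma card_inversions (w : P.weylGroup) : (inversions b w).card = length b w := by
  classical
  induction hn : length b w generalizing w with
  | zero =>
    rw [eq_one_of_length_eq_zero b hn, Finset.card_eq_zero, Finset.eq_empty_iff_forall_notMem]
    intro β
    rw [mem_inversions, inv_one, act_one]
    tauto
  | succ n ih =>
    obtain ⟨α, hα, h⟩ := exists_simple_length_lt (b := b) (w := w) (by
      rintro rfl
      rw [length_one] at hn
      omega)
    have hα' := RootPairing.Base.isPos_of_mem_support hα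
    have h1 : length b (w * refl P α) < length b (w * refl P α * refl P α) := by
      rwa [mul_refl_mul_refl]
    rw [lt_length_mul_refl_iff hα'] at h1
    have h2 := length_mul_simple hα h1
    rw [mul_refl_mul_refl, hn, add_left_inj] at h2
    have h3 := inversions_mul_simple hα h1
    rw [mul_refl_mul_refl] at h3
    rw [h3, Finset.card_insert_of_notMem (notMem_inversions hα'), ih _ h2.symm]

lemma isPos_act_iff_of_forall {w : P.weylGroup} (h : ∀ β, b.IsPos β → ¬ b.IsPos (act w β)) (β : ι) :
    b.IsPos (act w β) ↔ ¬ b.IsPos β := by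
  refine ⟨fun h1 h2 ↦ h β h2 h1, fun h1 ↦ ?_⟩
  have := h _ ((isPos_opp b β).2 h1)
  rwa [act_opp, isPos_opp, not_not] at this

lemma isPos_act_inv_iff_of_forall {w : P.weylGroup} (h : ∀ β, b.IsPos β → ¬ b.IsPos (act w β))
    (β : ι) : b.IsPos (act w⁻¹ β) ↔ ¬ b.IsPos β := by
  have := isPos_act_iff_of_forall h (act w⁻¹ β)
  rw [act_act_inv] at this
  tauto

lemma length_eq_flagDim {w : P.weylGroup} (h : ∀ β, b.IsPos β → ¬ b.IsPos (act w β)) :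
    length b w = flagDim b := by
  rw [← card_inversions, flagDim, Nat.subtype_card]
  exact fun β ↦ by rw [mem_inversions, isPos_act_inv_iff_of_forall h, not_not, and_self]

lemma eq_of_forall_not_isPos {v w : P.weylGroup} (hv : ∀ β, b.IsPos β → ¬ b.IsPos (act v β))
    (hw : ∀ β, b.IsPos β → ¬ b.IsPos (act w β)) : v = w := by
  rw [← inv_mul_eq_one]
  apply eq_one_of_length_eq_zero b
  rw [← card_inversions, Finset.card_eq_zero, Finset.eq_empty_iff_forall_notMem]
  intro β
  rw [mem_inversions, mul_inv_rev, inv_inv, act_mul, isPos_act_inv_iff_of_forall hw,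
    isPos_act_iff_of_forall hv, not_not]
  tauto

lemma not_isPos_act_longest (β : ι) (hβ : b.IsPos β) : ¬ b.IsPos (act (longest b) β) :=
  fun h ↦ (lt_length_mul_refl hβ h).not_ge (length_le_length_longest b _)

lemma length_longest : length b (longest b) = flagDim b :=
  length_eq_flagDim not_isPos_act_longest

/-- Positive roots are built by adding simple roots one at a time, so negativity of the images
spreads from the simple roots to all positive ones. -/
lemma eq_longest_of_forall_simple {w : P.weylGroup}
    (h : ∀ α ∈ b.support, ¬ b.IsPos (act w α)) : w = longest b := by
  refine eq_of_forall_not_isPos (fun β hβ ↦ ?_) not_isPos_act_longest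
  refine hβ.induction_on_add h fun i j k hk hi hj ↦ ?_
  rw [← isPos_opp, ← act_opp] at hi ⊢
  have hj' := h j hj
  rw [← isPos_opp, ← act_opp] at hj'
  refine hi.add hj' ?_
  simp only [root_act, root_opp, hk, smul_neg, smul_add, neg_add]

lemma eq_longest_of_length {w : P.weylGroup} (h : length b (longest b) ≤ length b w) :
    w = longest b := by
  refine eq_longest_of_forall_simple fun α hα h1 ↦ ?_
  have h2 := length_mul_simple hα h1
  have h3 := length_le_length_longest b (w * refl P α)
  omega

lemma BruhatLE.eq_or_length_lt {v w : P.weylGroup} (h : BruhatLE b v w) :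
    v = w ∨ length b v < length b w := by
  induction h with
  | refl => exact Or.inl rfl
  | tail _ h ih =>
    rcases ih with rfl | ih
    · exact Or.inr h.2
    · exact Or.inr (ih.trans h.2)

lemma BruhatLT.length_lt {v w : P.weylGroup} (h : BruhatLT b v w) : length b v < length b w :=
  h.1.eq_or_length_lt.resolve_left h.2

lemma bruhatLT_of_length_lt {w : P.weylGroup} {β : ι}
    (h : length b w < length b (w * refl P β)) : BruhatLT b w (w * refl P β) :=
  ⟨.single ⟨⟨β, rfl⟩, h⟩, fun h' ↦ h.ne (congrArg _ h')⟩

lemma bruhatLT_mul_refl_iff {w : P.weylGroup} {β : ι} :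
    BruhatLT b w (w * refl P β) ↔ length b w < length b (w * refl P β) :=
  ⟨BruhatLT.length_lt, bruhatLT_of_length_lt⟩

lemma bruhatLT_refl_mul_iff {w : P.weylGroup} {β : ι} :
    BruhatLT b (refl P β * w) w ↔ length b (refl P β * w) < length b w := by
  have h := bruhatLT_mul_refl_iff (b := b) (w := refl P β * w) (β := act w⁻¹ β)
  rwa [mul_assoc, mul_refl_act_inv, refl_mul_refl_mul] at h

lemma bruhatCovers_of_length_eq {w : P.weylGroup} {β : ι}
    (h : length b (w * refl P β) = length b w + 1) : BruhatCovers b (w * refl P β) w := by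
  refine ⟨bruhatLT_of_length_lt (h ▸ Nat.lt_succ_self _), ?_⟩
  rintro ⟨z, h1, h2⟩
  have := h1.length_lt
  have := h2.length_lt
  omega

end Length

end FlagSchubert

end

noncomputable section

namespace FlagSchubert

/-! ### Degree arguments in polynomial rings over ℤ -/

section Homogeneous

variable {σ : Type*}

lemma homogeneousComponent_mul_of_isHomogeneous {e : ℕ} (f : MvPolynomial σ ℤ)
    {g : MvPolynomial σ ℤ} (hg : g.IsHomogeneous e) (n : ℕ) :
    MvPolynomial.homogeneousComponent n (f * g) =
      if e ≤ n then MvPolynomial.homogeneousComponent (n - e) f * g else 0 := by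
  let := MvPolynomial.gradedAlgebra (σ := σ) (R := ℤ)
  have key (φ : MvPolynomial σ ℤ) (i : ℕ) :
      (DirectSum.decompose (MvPolynomial.homogeneousSubmodule σ ℤ) φ i : MvPolynomial σ ℤ) =
        MvPolynomial.homogeneousComponent i φ :=
    MvPolynomial.decomposition.decompose'_apply φ i
  simpa only [key] using DirectSum.coe_decompose_mul_of_right_mem
    (MvPolynomial.homogeneousSubmodule σ ℤ) (a := f) n hg

lemma isHomogeneous_of_mul {d e : ℕ} {f g : MvPolynomial σ ℤ} (hg : g.IsHomogeneous e)
    (hg0 : g ≠ 0) (h : (f * g).IsHomogeneous (d + e)) : f.IsHomogeneous d := by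
  have h1 := homogeneousComponent_mul_of_isHomogeneous f hg (d + e)
  rw [MvPolynomial.homogeneousComponent_eq_self h, if_pos (Nat.le_add_left _ _),
    Nat.add_sub_cancel] at h1
  rw [mul_right_cancel₀ hg0 h1]
  exact MvPolynomial.homogeneousComponent_isHomogeneous _ _

/-- A multiple of a form of degree e has no components below degree e. Every later vanishing
argument ends with this. -/
lemma mul_eq_zero_of_isHomogeneous_of_lt {d e : ℕ} {f g : MvPolynomial σ ℤ}
    (hg : g.IsHomogeneous e) (h : (f * g).IsHomogeneous d) (hde : d < e) : f * g = 0 := by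
  have h1 := homogeneousComponent_mul_of_isHomogeneous f hg d
  rwa [MvPolynomial.homogeneousComponent_eq_self h, if_neg hde.not_ge] at h1

lemma exists_eq_C_of_isHomogeneous_zero {f : MvPolynomial σ ℤ} (h : f.IsHomogeneous 0) :
    ∃ z, f = MvPolynomial.C z :=
  ⟨_, MvPolynomial.totalDegree_eq_zero_iff_eq_C.1 (Nat.le_zero.1 h.totalDegree_le)⟩

lemma exists_C_mul_eq_of_isHomogeneous {d : ℕ} {f g : MvPolynomial σ ℤ} (hg : g.IsHomogeneous d)
    (hf : f.IsHomogeneous d) (h : g ∣ f) : ∃ z, f = MvPolynomial.C z * g := by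
  by_cases hg0 : g = 0
  · exact ⟨0, by rw [hg0] at h; rw [zero_dvd_iff.1 h, hg0, mul_zero]⟩
  obtain ⟨q, rfl⟩ := h
  rw [mul_comm] at hf
  obtain ⟨z, rfl⟩ := exists_eq_C_of_isHomogeneous_zero
    (isHomogeneous_of_mul hg hg0 ((zero_add d).symm ▸ hf))
  exact ⟨z, mul_comm _ _⟩

end Homogeneous

variable {ι X Y : Type*} [AddCommGroup X] [AddCommGroup Y] {P : RootDatum ι X Y} (b : P.Base)

/-! ### Roots as prime linear forms -/

section RootPoly

/-- The polynomial attached to an element of the root lattice. -/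
def latticePoly : P.rootSpan ℤ →ₗ[ℤ] BaseRing b := b.toWeightBasisInt.constr ℤ MvPolynomial.X

lemma latticePoly_apply (x : P.rootSpan ℤ) :
    latticePoly b x = ∑ α, MvPolynomial.C (b.toWeightBasisInt.repr x α) * MvPolynomial.X α := by
  simp [latticePoly, Module.Basis.constr_apply_fintype]

lemma rootPoly_eq_latticePoly (i : ι) : rootPoly b i = latticePoly b (P.rootSpanMem ℤ i) :=
  (latticePoly_apply b _).symm

lemma latticePoly_injective : Function.Injective (latticePoly b) := by
  classical
  rw [injective_iff_map_eq_zero]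
  intro x hx
  rw [← b.toWeightBasisInt.repr.map_eq_zero_iff]
  ext α
  have := congrArg (MvPolynomial.coeff (Finsupp.single α 1)) hx
  rw [latticePoly_apply, MvPolynomial.coeff_sum] at this
  simp only [MvPolynomial.coeff_C_mul, MvPolynomial.coeff_X,
    Finsupp.single_left_inj (one_ne_zero : (1 : ℕ) ≠ 0), mul_ite, mul_one, mul_zero,
    Finset.sum_ite_eq', Finset.mem_univ, if_true, MvPolynomial.coeff_zero] at this
  exact this

variable {b}

lemma rootPoly_eq_add {i j k : ι} {z : ℤ} (h : P.root k = P.root i + z • P.root j) :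
    rootPoly b k = rootPoly b i + MvPolynomial.C z * rootPoly b j := by
  have h1 : P.rootSpanMem ℤ k = P.rootSpanMem ℤ i + z • P.rootSpanMem ℤ j := Subtype.ext h
  simp only [rootPoly_eq_latticePoly, h1, map_add, map_smul, MvPolynomial.C_mul']

lemma rootPoly_eq_C_mul_iff {i j : ι} {z : ℤ} :
    rootPoly b j = MvPolynomial.C z * rootPoly b i ↔ P.root j = z • P.root i := by
  simp only [rootPoly_eq_latticePoly, MvPolynomial.C_mul', ← map_smul]
  rw [(latticePoly_injective b).eq_iff, Subtype.ext_iff]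
  rfl

lemma rootPoly_opp (i : ι) : rootPoly b (opp P i) = -rootPoly b i := by
  have := (rootPoly_eq_C_mul_iff (b := b) (i := i) (j := opp P i) (z := -1)).2
    (by rw [root_opp, neg_one_smul])
  simpa using this

lemma rootPoly_act_refl (i j : ι) :
    rootPoly b (act (refl P i) j) =
      rootPoly b j - MvPolynomial.C (P.pairing j i) * rootPoly b i := by
  rw [rootPoly_eq_add (z := -P.pairing j i) (i := j) (j := i)
    (by rw [root_act_refl, neg_smul, sub_eq_add_neg]), map_neg, neg_mul, sub_eq_add_neg]

lemma rootPoly_simple (α : b.support) : rootPoly b α = MvPolynomial.X α := by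
  have h : P.rootSpanMem ℤ α = b.toWeightBasisInt α := by
    simp [RootPairing.Base.toWeightBasisInt]
  rw [rootPoly_eq_latticePoly, h, latticePoly, Module.Basis.constr_basis]

lemma isHomogeneous_rootPoly (i : ι) : (rootPoly b i).IsHomogeneous 1 :=
  .sum _ _ _ fun _ _ ↦ MvPolynomial.isHomogeneous_C_mul_X _ _

lemma isHomogeneous_prod_rootPoly (s : Finset ι) :
    (∏ i ∈ s, rootPoly b i).IsHomogeneous s.card := by
  simpa using MvPolynomial.IsHomogeneous.prod s _ (fun _ ↦ 1) fun i _ ↦ isHomogeneous_rootPoly i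

variable (b) in
/-- The action of a Weyl group element on the base ring. -/
def actPoly (w : P.weylGroup) : BaseRing b →ₐ[ℤ] BaseRing b :=
  MvPolynomial.aeval fun α ↦ rootPoly b (act w α)

variable [Finite ι]

lemma actPoly_rootPoly (w : P.weylGroup) (i : ι) :
    actPoly b w (rootPoly b i) = rootPoly b (act w i) := by
  induction i using b.induction_add with
  | h₀ i hi => rw [rootPoly_opp, map_neg, hi, act_opp, rootPoly_opp]
  | h₁ i hi =>
    rw [rootPoly_simple ⟨i, hi⟩, actPoly, MvPolynomial.aeval_X]
  | h₂ i j k hk hi hj =>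
    rw [rootPoly_eq_add (i := i) (j := j) (z := 1) (by rw [hk, one_smul]),
      rootPoly_eq_add (k := act w k) (i := act w i) (j := act w j) (z := 1)
        (by simp only [root_act, hk, one_smul, smul_add]),
      map_one, one_mul, one_mul, map_add, hi, rootPoly_simple ⟨j, hj⟩, actPoly,
      MvPolynomial.aeval_X]

lemma actPoly_actPoly_inv (w : P.weylGroup) :
    (actPoly b w).comp (actPoly b w⁻¹) = AlgHom.id ℤ _ := by
  refine MvPolynomial.algHom_ext fun α ↦ ?_
  rw [AlgHom.comp_apply, ← rootPoly_simple, actPoly_rootPoly, actPoly_rootPoly, act_act_inv,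
    AlgHom.id_apply]

lemma prime_rootPoly_act (w : P.weylGroup) {i : ι} (h : Prime (rootPoly b i)) :
    Prime (rootPoly b (act w i)) := by
  rw [← actPoly_rootPoly]
  refine (MulEquiv.prime_iff (AlgEquiv.ofAlgHom (actPoly b w) (actPoly b w⁻¹)
    (actPoly_actPoly_inv w) ?_)).2 h
  simpa using actPoly_actPoly_inv w⁻¹

variable [P.IsReduced]

/-- Simple roots are variables, hence prime. Every root is reached from them by reflections and sign
changes, and the Weyl group acts on the polynomial ring by automorphisms. -/
lemma prime_rootPoly (i : ι) : Prime (rootPoly b i) := by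
  induction i using b.induction_reflect with
  | h₀ i hi =>
    rw [rootPoly_opp]
    exact hi.neg
  | h₁ i hi =>
    rw [rootPoly_simple ⟨i, hi⟩]
    exact MvPolynomial.X_prime
  | h₂ i j hi hj => exact prime_rootPoly_act (refl P j) hi

lemma rootPoly_ne_zero (i : ι) : rootPoly b i ≠ 0 := (prime_rootPoly i).ne_zero

lemma eq_or_eq_opp_of_rootPoly_dvd {i j : ι} (h : rootPoly b i ∣ rootPoly b j) :
    i = j ∨ i = opp P j := by
  obtain ⟨z, hz⟩ := exists_C_mul_eq_of_isHomogeneous (isHomogeneous_rootPoly i)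
    (isHomogeneous_rootPoly j) h
  rw [rootPoly_eq_C_mul_iff] at hz
  have h2 : ¬ LinearIndependent ℤ ![P.root i, P.root j] := by
    rw [LinearIndependent.pair_iff]
    intro h3
    exact neg_ne_zero.2 one_ne_zero (h3 z (-1) (by rw [hz, neg_one_smul, add_neg_cancel])).2
  rcases RootPairing.IsReduced.eq_or_eq_neg i j h2 with h3 | h3
  · exact Or.inl (P.root.injective h3)
  · exact Or.inr (P.root.injective (h3.trans (root_opp j).symm))

lemma eq_of_rootPoly_dvd {i j : ι} (hi : b.IsPos i) (hj : b.IsPos j)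
    (h : rootPoly b i ∣ rootPoly b j) : i = j := by
  rcases eq_or_eq_opp_of_rootPoly_dvd h with h | h
  · exact h
  · rw [h, isPos_opp] at hi
    exact absurd hj hi

lemma prod_rootPoly_dvd {s : Finset ι} (hs : ∀ i ∈ s, b.IsPos i) {f : BaseRing b}
    (h : ∀ i ∈ s, rootPoly b i ∣ f) : ∏ i ∈ s, rootPoly b i ∣ f :=
  Finset.prod_dvd_of_isRelPrime
    (fun i hi j hj hij ↦ (prime_rootPoly i).irreducible.isRelPrime_iff_not_dvd.2
      fun h' ↦ hij (eq_of_rootPoly_dvd (hs i hi) (hs j hj) h')) h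

lemma not_rootPoly_dvd_prod {s : Finset ι} (hs : ∀ i ∈ s, b.IsPos i) {i : ι} (hi : b.IsPos i)
    (his : i ∉ s) : ¬ rootPoly b i ∣ ∏ j ∈ s, rootPoly b j := by
  rw [(prime_rootPoly i).dvd_finsetProd_iff]
  rintro ⟨j, hj, h⟩
  exact his (eq_of_rootPoly_dvd hi (hs j hj) h ▸ hj)

end RootPoly

end FlagSchubert

end

noncomputable section

namespace FlagSchubert

variable {ι X Y : Type*} [AddCommGroup X] [AddCommGroup Y] {P : RootDatum ι X Y} {b : P.Base}
  [Finite ι] [P.IsReduced]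

/-! ### Schubert classes: rigidity, divided differences, existence -/

section SchubertClass

variable (b) in
/-- The product of the positive roots `β` with `w⁻¹ β` negative. -/
def inversionPoly (w : P.weylGroup) : BaseRing b := ∏ β ∈ inversions b w, rootPoly b β

lemma isHomogeneous_inversionPoly (w : P.weylGroup) :
    (inversionPoly b w).IsHomogeneous (length b w) :=
  card_inversions (b := b) w ▸ isHomogeneous_prod_rootPoly _

lemma inversionPoly_ne_zero (w : P.weylGroup) : inversionPoly b w ≠ 0 :=
  Finset.prod_ne_zero_iff.2 fun β _ ↦ rootPoly_ne_zero β

lemma bruhatLT_refl_mul_iff_mem_inversions (w : P.weylGroup) (β : ι) :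
    b.IsPos β ∧ BruhatLT b (refl P β * w) w ↔ β ∈ inversions b w := by
  rw [mem_inversions, bruhatLT_refl_mul_iff]
  exact and_congr_right length_refl_mul_lt_iff

lemma finprod_rootPoly_eq (w : P.weylGroup) :
    ∏ᶠ (β : ι) (_ : b.IsPos β ∧ BruhatLT b (refl P β * w) w), rootPoly b β =
      inversionPoly b w := by
  simp only [bruhatLT_refl_mul_iff_mem_inversions]
  exact finprod_mem_finset_eq_prod _ _

lemma inversionPoly_mul_simple {w : P.weylGroup} {α : ι} (hα : α ∈ b.support)
    (h : b.IsPos (act w α)) :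
    inversionPoly b (w * refl P α) = rootPoly b (act w α) * inversionPoly b w := by
  classical
  rw [inversionPoly, inversions_mul_simple hα h, Finset.prod_insert
    (notMem_inversions (RootPairing.Base.isPos_of_mem_support hα)), inversionPoly]

lemma prod_dvd_apply {p : P.weylGroup → BaseRing b} (hp : p ∈ equivariantCohomology b)
    {w : P.weylGroup} {s : Finset ι} (hs : ∀ β ∈ s, b.IsPos β)
    (h : ∀ β ∈ s, p (refl P β * w) = 0) : ∏ β ∈ s, rootPoly b β ∣ p w :=
  prod_rootPoly_dvd hs fun β hβ ↦ by simpa [h β hβ] using hp w β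

lemma inversionPoly_dvd_apply {p : P.weylGroup → BaseRing b} (hp : p ∈ equivariantCohomology b)
    {w : P.weylGroup} (h : ∀ v, length b v < length b w → p v = 0) : inversionPoly b w ∣ p w := by
  refine prod_dvd_apply hp (fun β hβ ↦ (mem_inversions.1 hβ).1) fun β hβ ↦ h _ ?_
  rw [mem_inversions] at hβ
  exact (length_refl_mul_lt_iff hβ.1).2 hβ.2

/-- Induct on length. Once p vanishes at all elements shorter than v, its value at v is a multiple
of a form of degree l(v); if l(v) > d this exceeds the degree of p. -/
lemma eq_zero_of_vanishes {p : P.weylGroup → BaseRing b} (hp : p ∈ equivariantCohomology b)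
    {d : ℕ} (hd : ∀ v, (p v).IsHomogeneous d) (h : ∀ v, length b v ≤ d → p v = 0) : p = 0 := by
  funext v
  induction hn : length b v using Nat.strong_induction_on generalizing v with
  | h n ih =>
    rcases le_or_gt (length b v) d with h1 | h1
    · exact h v h1
    · obtain ⟨q, hq⟩ := inversionPoly_dvd_apply hp (w := v) fun u hu ↦ ih _ (hn ▸ hu) u rfl
      have h2 := hd v
      rw [hq, mul_comm] at h2 ⊢
      exact mul_eq_zero_of_isHomogeneous_of_lt (isHomogeneous_inversionPoly v) h2 h1

lemma IsSchubertClass.unique {w : P.weylGroup} {p q : P.weylGroup → BaseRing b}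
    (hp : IsSchubertClass b w p) (hq : IsSchubertClass b w q) : p = q := by
  rw [← sub_eq_zero]
  refine eq_zero_of_vanishes (sub_mem hp.mem hq.mem)
    (fun v ↦ (hp.homogeneous v).sub (hq.homogeneous v)) fun v hv ↦ ?_
  by_cases h : v = w
  · rw [h, Pi.sub_apply, hp.apply_self, hq.apply_self, sub_self]
  · rw [Pi.sub_apply, hp.vanishes v hv h, hq.vanishes v hv h, sub_zero]

/-- Divided differences with respect to the right action of a reflection. -/
lemma exists_mul_refl_eq_add {p : P.weylGroup → BaseRing b} (hp : p ∈ equivariantCohomology b)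
    (α : ι) : ∃ q ∈ equivariantCohomology b,
      ∀ v, p (v * refl P α) = p v + rootPoly b (act v α) * q v := by
  have h (v : P.weylGroup) : ∃ q, p (v * refl P α) = p v + rootPoly b (act v α) * q := by
    obtain ⟨q, hq⟩ := hp v (act v α)
    rw [refl_act_mul] at hq
    exact ⟨-q, by rw [mul_neg, ← hq]; ring⟩
  choose q hq using h
  refine ⟨q, fun v β ↦ ?_, hq⟩
  -- If β = ±vα, then r_β v = v r_α and q takes equal values at both points. Otherwise β is a prime
  -- not dividing vα, and the GKM condition for q follows by cancelling vα.
  by_cases h1 : rootPoly b β ∣ rootPoly b (act v α)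
  · have h2 : refl P β * v = v * refl P α := by
      rw [← refl_act_mul]
      rcases eq_or_eq_opp_of_rootPoly_dvd h1 with h1 | h1
      · rw [h1]
      · rw [h1, refl_opp]
    have h3 := hq (v * refl P α)
    rw [mul_refl_mul_refl, hq v, act_mul, act_refl_self, act_opp, rootPoly_opp] at h3
    have h4 : rootPoly b (act v α) * (q v - q (v * refl P α)) = 0 := by linear_combination -h3
    rw [h2, (mul_eq_zero.1 h4).resolve_left (rootPoly_ne_zero _)]
    exact dvd_zero _
  · refine ((prime_rootPoly β).dvd_or_dvd (a := rootPoly b (act v α)) ?_).resolve_left h1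
    have h2 := hp (v * refl P α) β
    have h3 := hp v β
    rw [← mul_assoc, hq, hq, act_mul, rootPoly_act_refl] at h2
    have h4 := (dvd_sub h2 h3).sub (dvd_mul_right (rootPoly b β)
      (MvPolynomial.C (P.pairing (act v α) β) * q (refl P β * v)))
    convert h4 using 1
    ring

/-- The divided difference of S_{wr} is S_w: it lowers the degree by one, and at w it removes the
factor wα, the extra inversion of wr. -/
lemma isSchubertClass_of_mul_simple {w : P.weylGroup} {α : ι} (hα : α ∈ b.support)
    (h : b.IsPos (act w α)) {p q : P.weylGroup → BaseRing b}
    (hp : IsSchubertClass b (w * refl P α) p) (hq : q ∈ equivariantCohomology b)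
    (hpq : ∀ v, p (v * refl P α) = p v + rootPoly b (act v α) * q v) :
    IsSchubertClass b w q := by
  have hl := length_mul_simple hα h
  have hpw : p w = 0 := hp.vanishes w (by omega) fun h' ↦ by
    have := congrArg (length b) h'
    omega
  refine ⟨hq, fun v ↦ ?_, fun v hv hvw ↦ ?_, ?_⟩
  · refine isHomogeneous_of_mul (isHomogeneous_rootPoly (act v α)) (rootPoly_ne_zero _) ?_
    rw [← hl, show q v * rootPoly b (act v α) = p (v * refl P α) - p v by rw [hpq v]; ring]
    exact (hp.homogeneous _).sub (hp.homogeneous _)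
  · have h1 := length_mul_simple_le v hα
    have h2 := hpq v
    rw [hp.vanishes (v * refl P α) (by omega) (fun h' ↦ hvw (mul_right_cancel h'))] at h2
    rw [hp.vanishes v (by omega) (fun h' ↦ ?_), zero_add, eq_comm, mul_eq_zero] at h2
    · exact h2.resolve_left (rootPoly_ne_zero _)
    · rw [h', hl] at hv
      omega
  · have h1 := hpq w
    rw [hp.apply_self, hpw, zero_add, finprod_rootPoly_eq, inversionPoly_mul_simple hα h] at h1
    rw [finprod_rootPoly_eq, mul_left_cancel₀ (rootPoly_ne_zero _) h1]

open scoped Classical in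
lemma isSchubertClass_longest :
    IsSchubertClass b (longest b) (Pi.single (longest b) (inversionPoly b (longest b))) := by
  refine ⟨fun w β ↦ ?_, fun v ↦ ?_, fun v _ hv ↦ Pi.single_eq_of_ne hv _, ?_⟩
  · have h1 : rootPoly b β ∣ inversionPoly b (longest b) := by
      have h2 (β : ι) (hβ : b.IsPos β) : rootPoly b β ∣ inversionPoly b (longest b) :=
        Finset.dvd_prod_of_mem _ (mem_inversions.2
          ⟨hβ, by rw [isPos_act_inv_iff_of_forall not_isPos_act_longest]; exact not_not.2 hβ⟩)
      by_cases hβ : b.IsPos β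
      · exact h2 β hβ
      · simpa only [rootPoly_opp, neg_dvd] using h2 _ ((isPos_opp b β).2 hβ)
    refine dvd_sub ?_ ?_ <;>
    · rw [Pi.single_apply]
      split_ifs
      · exact h1
      · exact dvd_zero _
  · rw [Pi.single_apply]
    split_ifs
    · exact isHomogeneous_inversionPoly _
    · exact MvPolynomial.isHomogeneous_zero _ _ _
  · rw [Pi.single_eq_same, finprod_rootPoly_eq]

/-- Downward induction from the longest element: any other w has a simple α with wα positive, and
S_w is a divided difference of S_{wr}. -/
lemma exists_isSchubertClass (w : P.weylGroup) : ∃ p, IsSchubertClass b w p := by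
  induction hn : length b (longest b) - length b w generalizing w with
  | zero =>
    rw [eq_longest_of_length (Nat.sub_eq_zero_iff_le.1 hn)]
    exact ⟨_, isSchubertClass_longest⟩
  | succ n ih =>
    have h1 : ∃ α ∈ b.support, b.IsPos (act w α) := by
      by_contra! h
      rw [eq_longest_of_forall_simple h] at hn
      omega
    obtain ⟨α, hα, h⟩ := h1
    obtain ⟨p, hp⟩ := ih (w * refl P α) (by rw [length_mul_simple hα h]; omega)
    obtain ⟨q, hq, hpq⟩ := exists_mul_refl_eq_add hp.mem α
    exact ⟨q, isSchubertClass_of_mul_simple hα h hp hq hpq⟩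

lemma isSchubertClass_schubertClass (w : P.weylGroup) :
    IsSchubertClass b w (schubertClass b w) :=
  Classical.epsilon_spec (exists_isSchubertClass w)

lemma schubertClass_mem (w : P.weylGroup) : schubertClass b w ∈ equivariantCohomology b :=
  (isSchubertClass_schubertClass w).mem

lemma isHomogeneous_schubertClass (w v : P.weylGroup) :
    (schubertClass b w v).IsHomogeneous (length b w) :=
  (isSchubertClass_schubertClass w).homogeneous v

lemma schubertClass_apply_self (w : P.weylGroup) : schubertClass b w w = inversionPoly b w := by
  rw [(isSchubertClass_schubertClass w).apply_self, finprod_rootPoly_eq]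

lemma schubertClass_apply_eq_zero {w v : P.weylGroup} (h : length b v ≤ length b w)
    (hvw : v ≠ w) : schubertClass b w v = 0 :=
  (isSchubertClass_schubertClass w).vanishes v h hvw

lemma schubertClass_mul_simple_apply {w : P.weylGroup} {α : ι} (hα : α ∈ b.support)
    (h : b.IsPos (act w α)) (v : P.weylGroup) :
    schubertClass b (w * refl P α) (v * refl P α) =
      schubertClass b (w * refl P α) v + rootPoly b (act v α) * schubertClass b w v := by
  obtain ⟨q, hq, hpq⟩ := exists_mul_refl_eq_add (schubertClass_mem (b := b) (w * refl P α)) α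
  rw [hpq, (isSchubertClass_of_mul_simple hα h (isSchubertClass_schubertClass _) hq hpq).unique
    (isSchubertClass_schubertClass w)]

/-- S_w is a divided difference along α, and these are invariant: compare the defining equation at v
and at vr, where vα changes sign. -/
lemma schubertClass_apply_mul_simple {w : P.weylGroup} {α : ι} (hα : α ∈ b.support)
    (h : b.IsPos (act w α)) (v : P.weylGroup) :
    schubertClass b w (v * refl P α) = schubertClass b w v := by
  have h1 := schubertClass_mul_simple_apply hα h v
  have h2 := schubertClass_mul_simple_apply hα h (v * refl P α)
  rw [mul_refl_mul_refl, act_mul, act_refl_self, act_opp, rootPoly_opp] at h2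
  refine mul_left_cancel₀ (rootPoly_ne_zero (b := b) (act v α)) ?_
  linear_combination h1 + h2

end SchubertClass

/-! ### The Schubert basis -/

section Basis

lemma finsum_smul_schubertClass_apply (c : P.weylGroup → BaseRing b) (v : P.weylGroup) :
    (∑ᶠ u, c u • schubertClass b u) v = ∑ᶠ u, c u * schubertClass b u v := by
  have := Fintype.ofFinite P.weylGroup
  simp only [finsum_eq_sum_of_fintype, Finset.sum_apply, Pi.smul_apply, smul_eq_mul]

lemma eq_zero_of_finsum_smul_schubertClass {c : P.weylGroup → BaseRing b}
    (h : ∑ᶠ u, c u • schubertClass b u = 0) : c = 0 := by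
  funext w
  induction hn : length b w using Nat.strong_induction_on generalizing w with
  | h n ih =>
    have h1 := congrFun h w
    rw [finsum_smul_schubertClass_apply, finsum_eq_single _ w, Pi.zero_apply, mul_eq_zero,
      schubertClass_apply_self] at h1
    · exact h1.resolve_right (inversionPoly_ne_zero w)
    · intro u hu
      rcases lt_or_ge (length b u) (length b w) with h2 | h2
      · rw [ih _ (hn ▸ h2) u rfl, Pi.zero_apply, zero_mul]
      · rw [schubertClass_apply_eq_zero h2 hu.symm, mul_zero]

lemma finsum_smul_schubertClass_injective {c c' : P.weylGroup → BaseRing b}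
    (h : ∑ᶠ u, c u • schubertClass b u = ∑ᶠ u, c' u • schubertClass b u) : c = c' := by
  have := Fintype.ofFinite P.weylGroup
  rw [← sub_eq_zero]
  apply eq_zero_of_finsum_smul_schubertClass
  simp only [finsum_eq_sum_of_fintype] at h ⊢
  simp only [Pi.sub_apply, sub_smul, Finset.sum_sub_distrib, h, sub_self]

open scoped Classical in
lemma mem_span_schubertClass {p : P.weylGroup → BaseRing b} (hp : p ∈ equivariantCohomology b) :
    p ∈ Submodule.span (BaseRing b) (Set.range (schubertClass b)) := by
  have := Fintype.ofFinite P.weylGroup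
  -- Triangular elimination by length: n bounds the lengths where p is already zero, and k counts
  -- the layers left to clear.
  suffices ∀ k n, length b (longest b) + 1 - n = k → ∀ p ∈ equivariantCohomology b,
      (∀ v, length b v < n → p v = 0) →
      p ∈ Submodule.span (BaseRing b) (Set.range (schubertClass b)) from
    this _ 0 rfl p hp fun v hv ↦ absurd hv (Nat.not_lt_zero _)
  intro k
  induction k with
  | zero =>
    intro n hn p hp h
    have : p = 0 := funext fun v ↦ h v (by have := length_le_length_longest b v; omega)
    rw [this]
    exact zero_mem _
  | succ k ih =>
    intro n hn p hp h
    have h1 (w : P.weylGroup) : ∃ c, length b w = n → p w = c * schubertClass b w w := by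
      by_cases hw : length b w = n
      · obtain ⟨c, hc⟩ := inversionPoly_dvd_apply hp (w := w) fun v hv ↦ h v (hw ▸ hv)
        exact ⟨c, fun _ ↦ by rw [hc, schubertClass_apply_self, mul_comm]⟩
      · exact ⟨0, fun h' ↦ absurd h' hw⟩
    choose c hc using h1
    have h2 : ∑ w with length b w = n, c w • schubertClass b w ∈ equivariantCohomology b :=
      sum_mem fun w _ ↦ Subalgebra.smul_mem _ (schubertClass_mem w) _
    have h3 : ∑ w with length b w = n, c w • schubertClass b w ∈
        Submodule.span (BaseRing b) (Set.range (schubertClass b)) :=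
      sum_mem fun w _ ↦ Submodule.smul_mem _ _ (Submodule.subset_span ⟨w, rfl⟩)
    rw [← sub_add_cancel p (∑ w with length b w = n, c w • schubertClass b w)]
    refine add_mem (ih (n + 1) (by omega) _ (sub_mem hp h2) fun v hv ↦ ?_) h3
    simp only [Pi.sub_apply, Finset.sum_apply, Pi.smul_apply, smul_eq_mul]
    by_cases hvn : length b v = n
    · rw [Finset.sum_eq_single v, ← hc v hvn, sub_self]
      · intro u hu huv
        rw [Finset.mem_filter] at hu
        rw [schubertClass_apply_eq_zero (by omega) huv.symm, mul_zero]
      · intro h'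
        simp [hvn] at h'
    · rw [h v (by omega), zero_sub, neg_eq_zero]
      refine Finset.sum_eq_zero fun u hu ↦ ?_
      rw [Finset.mem_filter] at hu
      rw [schubertClass_apply_eq_zero (by omega), mul_zero]
      rintro rfl
      exact hvn hu.2

lemma exists_eq_finsum_schubertClass {p : P.weylGroup → BaseRing b}
    (hp : p ∈ equivariantCohomology b) :
    ∃ c : P.weylGroup → BaseRing b, p = ∑ᶠ u, c u • schubertClass b u := by
  have := Fintype.ofFinite P.weylGroup
  obtain ⟨c, hc⟩ := (Submodule.mem_span_range_iff_exists_fun _).1 (mem_span_schubertClass hp)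
  exact ⟨c, by rw [← hc, finsum_eq_sum_of_fintype]⟩

lemma schubertCoeff_finsum (c : P.weylGroup → BaseRing b) :
    schubertCoeff b (∑ᶠ u, c u • schubertClass b u) = c :=
  finsum_smul_schubertClass_injective
    (Classical.epsilon_spec (p := fun c' : P.weylGroup → BaseRing b ↦
      ∑ᶠ u, c u • schubertClass b u = ∑ᶠ u, c' u • schubertClass b u) ⟨c, rfl⟩).symm

end Basis

/-! ### The ordinary integral -/

section Integral

lemma ordinaryIntegral_finsum (c : P.weylGroup → BaseRing b) :
    ordinaryIntegral b (∑ᶠ u, c u • schubertClass b u) =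
      MvPolynomial.constantCoeff (c (longest b)) := by
  rw [ordinaryIntegral, schubertCoeff_finsum]

lemma ordinaryIntegral_add {p q : P.weylGroup → BaseRing b} (hp : p ∈ equivariantCohomology b)
    (hq : q ∈ equivariantCohomology b) :
    ordinaryIntegral b (p + q) = ordinaryIntegral b p + ordinaryIntegral b q := by
  have := Fintype.ofFinite P.weylGroup
  obtain ⟨c, rfl⟩ := exists_eq_finsum_schubertClass hp
  obtain ⟨c', rfl⟩ := exists_eq_finsum_schubertClass hq
  have h : ∑ᶠ u, c u • schubertClass b u + ∑ᶠ u, c' u • schubertClass b u =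
      ∑ᶠ u, (c + c') u • schubertClass b u := by
    simp only [finsum_eq_sum_of_fintype, Pi.add_apply, add_smul, Finset.sum_add_distrib]
  rw [h, ordinaryIntegral_finsum, ordinaryIntegral_finsum, ordinaryIntegral_finsum, Pi.add_apply,
    map_add]

lemma ordinaryIntegral_smul (f : BaseRing b) {p : P.weylGroup → BaseRing b}
    (hp : p ∈ equivariantCohomology b) :
    ordinaryIntegral b (f • p) = MvPolynomial.constantCoeff f * ordinaryIntegral b p := by
  have := Fintype.ofFinite P.weylGroup
  obtain ⟨c, rfl⟩ := exists_eq_finsum_schubertClass hp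
  have h : f • ∑ᶠ u, c u • schubertClass b u = ∑ᶠ u, (f • c) u • schubertClass b u := by
    simp only [finsum_eq_sum_of_fintype, Finset.smul_sum, Pi.smul_apply, smul_smul, smul_eq_mul]
  rw [h, ordinaryIntegral_finsum, ordinaryIntegral_finsum, Pi.smul_apply, smul_eq_mul, map_mul]

variable (b) in
/-- The integral in ordinary cohomology as a homomorphism on equivariant cohomology. -/
def integralHom : equivariantCohomology b →+ ℤ :=
  AddMonoidHom.mk' (fun p ↦ ordinaryIntegral b p) fun p q ↦ ordinaryIntegral_add p.2 q.2

lemma integralHom_apply (p : equivariantCohomology b) :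
    integralHom b p = ordinaryIntegral b (p : P.weylGroup → BaseRing b) := rfl

lemma integralHom_smul (f : BaseRing b) (p : equivariantCohomology b) :
    integralHom b (f • p) = MvPolynomial.constantCoeff f * integralHom b p :=
  ordinaryIntegral_smul f p.2

variable (b) in
/-- The Schubert class as an element of equivariant cohomology. -/
def schubert (w : P.weylGroup) : equivariantCohomology b := ⟨schubertClass b w, schubertClass_mem w⟩

open scoped Classical in
lemma integralHom_schubert (w : P.weylGroup) :
    integralHom b (schubert b w) = if w = longest b then 1 else 0 := by
  have h : schubertClass b w =
      ∑ᶠ u, (Pi.single w 1 : P.weylGroup → BaseRing b) u • schubertClass b u := by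
    rw [finsum_eq_single _ w fun u hu ↦ by rw [Pi.single_eq_of_ne hu, zero_smul],
      Pi.single_eq_same, one_smul]
  change ordinaryIntegral b (schubertClass b w) = _
  rw [h, ordinaryIntegral_finsum, Pi.single_apply]
  simp only [eq_comm (a := w)]
  split_ifs
  · exact map_one _
  · exact map_zero _

/-- By uniqueness of the expansion, the coefficient of S_u is homogeneous of degree d − l(u), or 0
if l(u) > d. At the longest element its constant term therefore vanishes unless d is the top degree.
-/
lemma integralHom_eq_zero_of_isHomogeneous {p : equivariantCohomology b} {d : ℕ}
    (hp : ∀ v, (p.1 v).IsHomogeneous d) (hd : d ≠ length b (longest b)) :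
    integralHom b p = 0 := by
  have := Fintype.ofFinite P.weylGroup
  obtain ⟨p, hpm⟩ := p
  obtain ⟨c, rfl⟩ := exists_eq_finsum_schubertClass hpm
  have h : c = fun u ↦ if length b u ≤ d then
      MvPolynomial.homogeneousComponent (d - length b u) (c u) else 0 := by
    apply finsum_smul_schubertClass_injective
    funext v
    have h1 : MvPolynomial.homogeneousComponent d ((∑ᶠ u, c u • schubertClass b u) v) =
      (∑ᶠ u, c u • schubertClass b u) v := MvPolynomial.homogeneousComponent_eq_self (hp v)
    rw [finsum_smul_schubertClass_apply] at h1 ⊢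
    rw [finsum_smul_schubertClass_apply, ← h1]
    simp only [finsum_eq_sum_of_fintype, map_sum]
    refine Finset.sum_congr rfl fun u _ ↦ ?_
    rw [homogeneousComponent_mul_of_isHomogeneous _ (isHomogeneous_schubertClass u v), ite_mul,
      zero_mul]
  rw [integralHom_apply, ordinaryIntegral_finsum, congrFun h]
  split_ifs with h1
  · rw [MvPolynomial.constantCoeff_eq, MvPolynomial.coeff_homogeneousComponent, if_neg]
    rw [map_zero]
    omega
  · exact map_zero _

end Integral

end FlagSchubert

end

noncomputable section

namespace FlagSchubert

variable {ι X Y : Type*} [AddCommGroup X] [AddCommGroup Y] {P : RootDatum ι X Y} {b : P.Base}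
  [Finite ι] [P.IsReduced]

/-! ### Values of a Schubert class one step above its own element -/

section Covers

open scoped Classical in
variable (b) in
/-- The positive roots `β` such that `w r_β` is longer than `w` by one. -/
def coverRoots (w : P.weylGroup) : Finset ι :=
  {β ∈ (Set.toFinite (Set.univ : Set ι)).toFinset |
    b.IsPos β ∧ length b (w * refl P β) = length b w + 1}

lemma mem_coverRoots {w : P.weylGroup} {β : ι} :
    β ∈ coverRoots b w ↔ b.IsPos β ∧ length b (w * refl P β) = length b w + 1 := by
  simp [coverRoots]

lemma isPos_act_of_mem_coverRoots {w : P.weylGroup} {β : ι} (h : β ∈ coverRoots b w) :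
    b.IsPos (act w β) := by
  rw [mem_coverRoots] at h
  exact (lt_length_mul_refl_iff h.1).1 (by omega)

lemma simple_mem_coverRoots {w : P.weylGroup} {α : ι} (hα : α ∈ b.support)
    (h : b.IsPos (act w α)) : α ∈ coverRoots b w :=
  mem_coverRoots.2 ⟨RootPairing.Base.isPos_of_mem_support hα, length_mul_simple hα h⟩

lemma act_inv_mul_refl (w : P.weylGroup) (β δ : ι) :
    act (w * refl P β)⁻¹ δ = act w⁻¹ (act (refl P (act w β)) δ) := by
  rw [← refl_act_mul, mul_inv_rev, refl_inv, act_mul]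

lemma act_mem_inversions_mul_refl {w : P.weylGroup} {β : ι} (hβ : b.IsPos β)
    (h : b.IsPos (act w β)) : act w β ∈ inversions b (w * refl P β) := by
  rw [mem_inversions, act_inv_mul_refl, act_refl_self, act_opp, act_inv_act, isPos_opp, not_not]
  exact ⟨h, hβ⟩

lemma not_isPos_act_inv_act_refl {w : P.weylGroup} {β δ : ι} (hβ : b.IsPos β)
    (h : b.IsPos (act w β)) (hδ : δ ∈ inversions b w)
    (hδ' : ¬ b.IsPos (act (refl P (act w β)) δ)) :
    ¬ b.IsPos (act w⁻¹ (act (refl P (act w β)) δ)) := by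
  rw [mem_inversions] at hδ
  obtain ⟨h1, h2⟩ := hδ
  set k := P.pairing δ (act w β)
  have h3 : b.height (act (refl P (act w β)) δ) = b.height δ + (-k) • b.height (act w β) :=
    b.height_add_zsmul (by rw [root_act_refl, neg_smul, sub_eq_add_neg])
  have h4 : b.height (act w⁻¹ (act (refl P (act w β)) δ)) =
      b.height (act w⁻¹ δ) + (-k) • b.height β :=
    b.height_add_zsmul (by
      rw [root_act, root_act_refl, smul_sub, ← root_act, smul_comm, ← root_act, act_inv_act,
        neg_smul, sub_eq_add_neg])
  rw [RootPairing.Base.isPos_iff] at h1 h2 h hβ hδ' ⊢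
  rw [h3] at hδ'
  rw [h4]
  simp only [smul_eq_mul, not_lt] at *
  -- With γ = wβ, δ − kγ is negative while δ and γ are positive, so k > 0. Then w⁻¹δ − kβ has
  -- negative height, since w⁻¹δ is already negative.
  have hk : 0 < k := by
    by_contra! hk
    nlinarith
  nlinarith

lemma dvd_prod_sub_prod {R κ : Type*} [CommRing R] {c : R} {s : Finset κ} {f g : κ → R}
    (h : ∀ i ∈ s, c ∣ f i - g i) : c ∣ ∏ i ∈ s, f i - ∏ i ∈ s, g i := by
  simp only [← Ideal.mem_span_singleton, ← Ideal.Quotient.eq] at h ⊢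
  rw [map_prod, map_prod]
  exact Finset.prod_congr rfl h

open scoped Classical in
-- With γ = wβ, reflection in γ is the identity modulo γ. Replacing each inversion δ by r_γδ when
-- that is positive, and keeping it otherwise, matches the two index sets; they are equinumerous
-- because the length rises by exactly one.
lemma rootPoly_dvd_inversionPoly_sub {w : P.weylGroup} {β : ι} (h : β ∈ coverRoots b w) :
    rootPoly b (act w β) ∣ inversionPoly b w -
      ∏ δ ∈ (inversions b (w * refl P β)).erase (act w β), rootPoly b δ := by
  have hw := isPos_act_of_mem_coverRoots h
  obtain ⟨hβ, hl⟩ := mem_coverRoots.1 h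
  have hmem := act_mem_inversions_mul_refl hβ hw
  set γ := act w β with hγ
  set φ : ι → ι := fun δ ↦ if b.IsPos (act (refl P γ) δ) then act (refl P γ) δ else δ with hφ
  have hinv (δ : ι) : act (refl P γ) (act (refl P γ) δ) = δ := P.reflectionPerm_self γ δ
  have hinj : Set.InjOn φ (inversions b w) := by
    intro δ hδ ε hε hδε
    rw [Finset.mem_coe, mem_inversions] at hδ hε
    simp only [hφ] at hδε
    split_ifs at hδε with h1 h2 h2
    · exact (act _).injective hδε
    · rw [← hδε, hinv] at h2
      exact absurd hδ.1 h2
    · rw [hδε, hinv] at h1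
      exact absurd hε.1 h1
    · exact hδε
  have himage : (inversions b w).image φ ⊆ (inversions b (w * refl P β)).erase γ := by
    intro ε hε
    obtain ⟨δ, hδ, rfl⟩ := Finset.mem_image.1 hε
    have hδ' := mem_inversions.1 hδ
    simp only [hφ]
    rw [Finset.mem_erase, mem_inversions, act_inv_mul_refl, ← hγ]
    split_ifs with h1
    · refine ⟨fun h2 ↦ ?_, h1, by rw [hinv]; exact hδ'.2⟩
      rw [← hinv δ, h2, act_refl_self, isPos_opp] at hδ'
      exact hδ'.1 hw
    · refine ⟨?_, hδ'.1, not_isPos_act_inv_act_refl hβ hw hδ h1⟩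
      rintro rfl
      rw [hγ, act_inv_act] at hδ'
      exact hδ'.2 hβ
  have heq := Finset.eq_of_subset_of_card_le himage (by
    rw [Finset.card_image_of_injOn hinj, Finset.card_erase_of_mem hmem, card_inversions,
      card_inversions, hl, Nat.add_sub_cancel])
  rw [← heq, Finset.prod_image hinj]
  refine dvd_prod_sub_prod fun δ _ ↦ ?_
  simp only [hφ]
  split_ifs
  · rw [rootPoly_act_refl, sub_sub_cancel]
    exact dvd_mul_left _ _
  · rw [sub_self]
    exact dvd_zero _

open scoped Classical in
-- Divisibility and degree determine the value up to an integer m. Comparing with the value at w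
-- modulo γ = wβ makes γ divide the constant m − 1, so m = 1.
lemma schubertClass_apply_mul_refl {w : P.weylGroup} {β : ι} (h : β ∈ coverRoots b w) :
    schubertClass b w (w * refl P β) =
      ∏ δ ∈ (inversions b (w * refl P β)).erase (act w β), rootPoly b δ := by
  have hw := isPos_act_of_mem_coverRoots h
  obtain ⟨hβ, hl⟩ := mem_coverRoots.1 h
  have hmem := act_mem_inversions_mul_refl hβ hw
  have hpos (δ : ι) (hδ : δ ∈ (inversions b (w * refl P β)).erase (act w β)) : b.IsPos δ :=
    (mem_inversions.1 (Finset.mem_of_mem_erase hδ)).1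
  have h1 : ∏ δ ∈ (inversions b (w * refl P β)).erase (act w β), rootPoly b δ ∣
      schubertClass b w (w * refl P β) := by
    refine prod_dvd_apply (schubertClass_mem w) hpos fun δ hδ ↦ ?_
    have hδ' := hpos δ hδ
    rw [Finset.mem_erase, mem_inversions] at hδ
    have h2 := (length_refl_mul_lt_iff hδ').2 hδ.2.2
    refine schubertClass_apply_eq_zero (by omega) fun h3 ↦ hδ.1 ?_
    refine eq_of_refl_eq b hδ' hw (mul_right_cancel (b := w * refl P β) ?_)
    rw [h3, ← refl_act_mul, refl_mul_refl_mul]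
  have hcard : ((inversions b (w * refl P β)).erase (act w β)).card = length b w := by
    rw [Finset.card_erase_of_mem hmem, card_inversions, hl, Nat.add_sub_cancel]
  obtain ⟨m, hm⟩ := exists_C_mul_eq_of_isHomogeneous (hcard ▸ isHomogeneous_prod_rootPoly _)
    (isHomogeneous_schubertClass w _) h1
  have h2 := schubertClass_mem (b := b) w (w * refl P β) (act w β)
  rw [← mul_assoc, refl_act_mul, mul_refl_mul_refl, schubertClass_apply_self, hm] at h2
  have h3 := dvd_add h2 (rootPoly_dvd_inversionPoly_sub h)
  rw [sub_add_sub_cancel, ← sub_one_mul] at h3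
  have h4 := ((prime_rootPoly _).dvd_or_dvd h3).resolve_right
    (not_rootPoly_dvd_prod hpos hw (Finset.notMem_erase _ _))
  rw [← map_one MvPolynomial.C, ← map_sub] at h4
  obtain ⟨q, hq⟩ := h4
  have h5 := MvPolynomial.isHomogeneous_C b.support (m - 1)
  rw [hq, mul_comm] at h5
  have h6 := mul_eq_zero_of_isHomogeneous_of_lt (isHomogeneous_rootPoly _) h5 one_pos
  rw [mul_comm, ← hq, MvPolynomial.C_eq_zero, sub_eq_zero] at h6
  rw [hm, h6, map_one, one_mul]

lemma schubertClass_apply_eq_zero_of_not_cover {w v : P.weylGroup}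
    (hl : length b v = length b w + 1) (h : ∀ β ∈ coverRoots b w, v ≠ w * refl P β) :
    schubertClass b w v = 0 := by
  have h1 : inversionPoly b v ∣ schubertClass b w v := by
    refine prod_dvd_apply (schubertClass_mem w) (fun β hβ ↦ (mem_inversions.1 hβ).1)
      fun β hβ ↦ ?_
    rw [mem_inversions] at hβ
    have h2 := (length_refl_mul_lt_iff hβ.1).2 hβ.2
    refine schubertClass_apply_eq_zero (by omega) fun h3 ↦ ?_
    have h4 : v = w * refl P (act w⁻¹ β) := by rw [mul_refl_act_inv, ← h3, refl_mul_refl_mul]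
    refine h (act w⁻¹ β) (mem_coverRoots.2 ⟨?_, h4 ▸ hl⟩) h4
    have h5 := hβ.2
    rwa [h4, act_inv_mul_refl, act_act_inv, act_refl_self, act_opp, isPos_opp, not_not] at h5
  obtain ⟨q, hq⟩ := h1
  have h2 := isHomogeneous_schubertClass (b := b) w v
  rw [hq, mul_comm] at h2 ⊢
  exact mul_eq_zero_of_isHomogeneous_of_lt (isHomogeneous_inversionPoly v) h2 (by omega)

end Covers

/-! ### The equivariant Chevalley formula -/

section Chevalley

variable (b) in
/-- The equivariant class of degree `1` with value `v α` at `v`. -/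
def chernClass (α : ι) : equivariantCohomology b :=
  ⟨fun v ↦ rootPoly b (act v α), fun v β ↦ by
    simp only [act_mul, rootPoly_act_refl, sub_sub_cancel]
    exact dvd_mul_left _ _⟩

lemma coe_sum_apply {κ : Type*} (s : Finset κ) (f : κ → equivariantCohomology b)
    (v : P.weylGroup) :
    (∑ i ∈ s, f i : equivariantCohomology b).1 v = ∑ i ∈ s, (f i).1 v := by
  rw [AddSubmonoidClass.coe_finsetSum, Finset.sum_apply]

/-- The equivariant Chevalley formula. -/
lemma chernClass_mul_schubert (α : ι) (w : P.weylGroup) :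
    chernClass b α * schubert b w = rootPoly b (act w α) • schubert b w -
      ∑ β ∈ coverRoots b w,
        (MvPolynomial.C (P.pairing α β) : BaseRing b) • schubert b (w * refl P β) := by
  rw [← sub_eq_zero, sub_sub_eq_add_sub, add_sub_right_comm]
  have happ (v : P.weylGroup) : (chernClass b α * schubert b w -
      rootPoly b (act w α) • schubert b w + ∑ β ∈ coverRoots b w,
        (MvPolynomial.C (P.pairing α β) : BaseRing b) • schubert b (w * refl P β)).1 v =
      (rootPoly b (act v α) - rootPoly b (act w α)) * schubertClass b w v +
      ∑ β ∈ coverRoots b w, MvPolynomial.C (P.pairing α β) * schubertClass b (w * refl P β) v := by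
    rw [sub_mul]
    change _ - _ + (∑ β ∈ coverRoots b w, _ : equivariantCohomology b).1 v = _
    rw [coe_sum_apply]
    rfl
  -- By rigidity it suffices to compare both sides at elements of length at most l(w) + 1: at covers
  -- wr_β both contributions are explicit, and elsewhere every term vanishes.
  refine Subtype.ext (eq_zero_of_vanishes (Subtype.prop _) (d := length b w + 1)
    (fun v ↦ ?_) fun v hv ↦ ?_)
  · rw [happ, add_comm (length b w) 1]
    refine (((isHomogeneous_rootPoly _).sub (isHomogeneous_rootPoly _)).mul
      (isHomogeneous_schubertClass w v)).add (.sum _ _ _ fun β hβ ↦ ?_)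
    rw [add_comm, ← (mem_coverRoots.1 hβ).2]
    exact (isHomogeneous_schubertClass _ v).C_mul _
  rw [happ]
  by_cases hcov : ∃ β ∈ coverRoots b w, v = w * refl P β
  · classical
    obtain ⟨β, hβ, rfl⟩ := hcov
    have hβ' := mem_coverRoots.1 hβ
    rw [Finset.sum_eq_single_of_mem β hβ, schubertClass_apply_mul_refl hβ, schubertClass_apply_self,
      inversionPoly, ← Finset.mul_prod_erase _ _
        (act_mem_inversions_mul_refl hβ'.1 (isPos_act_of_mem_coverRoots hβ)),
      ← refl_act_mul, act_mul, rootPoly_act_refl, pairing_act]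
    · ring
    · intro ε hε hεβ
      have hε' := mem_coverRoots.1 hε
      rw [schubertClass_apply_eq_zero (by omega), mul_zero]
      exact fun h ↦ hεβ (eq_of_refl_eq b hε'.1 hβ'.1 (mul_left_cancel h.symm))
  · push Not at hcov
    rw [Finset.sum_eq_zero, add_zero]
    · by_cases hvw : v = w
      · rw [hvw, sub_self, zero_mul]
      · rcases Nat.lt_or_ge (length b w) (length b v) with hl | hl
        · rw [schubertClass_apply_eq_zero_of_not_cover (by omega) hcov, mul_zero]
        · rw [schubertClass_apply_eq_zero hl hvw, mul_zero]
    · intro β hβ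
      have hβ' := mem_coverRoots.1 hβ
      rw [schubertClass_apply_eq_zero (by omega) (hcov β hβ), mul_zero]

end Chevalley

/-! ### Right reflection, anti-invariance of the integral, and the recurrence -/

section Recurrence

variable (b) in
/-- The right action of a reflection on equivariant cohomology. -/
def reflHom (α : ι) : equivariantCohomology b →ₐ[BaseRing b] equivariantCohomology b where
  toFun p := ⟨fun v ↦ p.1 (v * refl P α), fun v β ↦ by
    simpa only [mul_assoc] using p.2 (v * refl P α) β⟩
  map_one' := rfl
  map_mul' _ _ := rfl
  map_zero' := rfl
  map_add' _ _ := rfl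
  commutes' _ := rfl

lemma reflHom_chernClass (α : ι) : reflHom b α (chernClass b α) = -chernClass b α := by
  refine Subtype.ext (funext fun v ↦ ?_)
  change rootPoly b (act (v * refl P α) α) = -rootPoly b (act v α)
  rw [act_mul, act_refl_self, act_opp, rootPoly_opp]

lemma reflHom_schubert {w : P.weylGroup} {α : ι} (hα : α ∈ b.support) (h : b.IsPos (act w α)) :
    reflHom b α (schubert b w) = schubert b w :=
  Subtype.ext (funext fun v ↦ schubertClass_apply_mul_simple hα h v)

lemma reflHom_schubert_mul {w : P.weylGroup} {α : ι} (hα : α ∈ b.support)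
    (h : b.IsPos (act w α)) :
    reflHom b α (schubert b (w * refl P α)) =
      schubert b (w * refl P α) + chernClass b α * schubert b w :=
  Subtype.ext (funext fun v ↦ schubertClass_mul_simple_apply hα h v)

lemma constantCoeff_rootPoly (i : ι) : MvPolynomial.constantCoeff (rootPoly b i) = 0 := by
  simp [rootPoly]

/-- The Chevalley formula in ordinary cohomology. -/
lemma integralHom_chernClass_mul (α : ι) (w : P.weylGroup) (p : equivariantCohomology b) :
    integralHom b (chernClass b α * schubert b w * p) =
      -∑ β ∈ coverRoots b w,
        P.pairing α β * integralHom b (schubert b (w * refl P β) * p) := by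
  rw [chernClass_mul_schubert, sub_mul, smul_mul_assoc, Finset.sum_mul, map_sub,
    integralHom_smul, constantCoeff_rootPoly, zero_mul, zero_sub, map_sum]
  simp only [smul_mul_assoc, integralHom_smul, MvPolynomial.constantCoeff_C]

lemma isPos_act_mul_refl_iff (w : P.weylGroup) (α : ι) :
    b.IsPos (act (w * refl P α) α) ↔ ¬ b.IsPos (act w α) := by
  rw [act_mul, act_refl_self, act_opp, isPos_opp]

/-- If wα is positive, S_w is invariant and has integral 0. Otherwise its image is S_w + c S_{wr};
for w longest, Chevalley gives 1 − 2 = −1, and for other w all terms are below top degree. -/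
lemma integralHom_reflHom_schubert (w : P.weylGroup) {α : ι} (hα : α ∈ b.support) :
    integralHom b (reflHom b α (schubert b w)) = -integralHom b (schubert b w) := by
  classical
  have hα' := RootPairing.Base.isPos_of_mem_support hα
  by_cases h : b.IsPos (act w α)
  · rw [reflHom_schubert hα h, integralHom_schubert, if_neg, neg_zero]
    rintro rfl
    exact not_isPos_act_longest α hα' h
  · have h1 := (isPos_act_mul_refl_iff w α).2 h
    have h2 := reflHom_schubert_mul hα h1
    have h3 := simple_mem_coverRoots hα h1
    have h4 := length_mul_simple hα h1
    have h5 := integralHom_chernClass_mul α (w * refl P α) (1 : equivariantCohomology b)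
    simp only [mul_one, integralHom_schubert] at h5
    rw [mul_refl_mul_refl] at h2 h4
    rw [h2, map_add, h5, integralHom_schubert]
    by_cases hw : w = longest b
    · rw [Finset.sum_eq_single_of_mem α h3, mul_refl_mul_refl, if_pos hw, P.pairing_same]
      · norm_num
      · intro β hβ hβα
        rw [if_neg, mul_zero]
        intro h6
        rw [← hw, mul_assoc, mul_eq_left, mul_eq_one_iff_eq_inv, refl_inv] at h6
        exact hβα (eq_of_refl_eq b (mem_coverRoots.1 hβ).1 hα' h6.symm)
    · rw [Finset.sum_eq_zero, if_neg hw]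
      · norm_num
      · intro β hβ
        rw [if_neg, mul_zero]
        intro h6
        have h7 := (mem_coverRoots.1 hβ).2
        rw [h6, ← h4] at h7
        exact hw (eq_longest_of_length h7.le)

lemma exists_eq_sum_schubert (p : equivariantCohomology b) :
    ∃ c : P.weylGroup → BaseRing b, p = ∑ᶠ u, c u • schubert b u := by
  have := Fintype.ofFinite P.weylGroup
  obtain ⟨c, hc⟩ := exists_eq_finsum_schubertClass p.2
  refine ⟨c, Subtype.ext (funext fun v ↦ ?_)⟩
  rw [finsum_eq_sum_of_fintype, coe_sum_apply, hc, finsum_smul_schubertClass_apply,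
    finsum_eq_sum_of_fintype]
  rfl

lemma integralHom_reflHom {α : ι} (hα : α ∈ b.support) (p : equivariantCohomology b) :
    integralHom b (reflHom b α p) = -integralHom b p := by
  have := Fintype.ofFinite P.weylGroup
  obtain ⟨c, rfl⟩ := exists_eq_sum_schubert p
  rw [finsum_eq_sum_of_fintype]
  simp only [map_sum, map_smul, integralHom_smul, integralHom_reflHom_schubert _ hα, mul_neg,
    Finset.sum_neg_distrib]

lemma integralHom_eq_zero_of_reflHom_eq {α : ι} (hα : α ∈ b.support) {p : equivariantCohomology b}
    (h : reflHom b α p = p) : integralHom b p = 0 := by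
  have := integralHom_reflHom hα p
  rw [h] at this
  omega

open scoped Classical in
lemma integralHom_recurrence {u v w : P.weylGroup} {α : ι} (hα : α ∈ b.support)
    (hu : b.IsPos (act u α)) (hv : b.IsPos (act v α)) (hw : b.IsPos (act w α)) :
    integralHom b (schubert b w * schubert b (v * refl P α) * schubert b (u * refl P α)) =
      integralHom b (schubert b (w * refl P α) * schubert b (v * refl P α) * schubert b u) +
      integralHom b (schubert b (w * refl P α) * schubert b v * schubert b (u * refl P α)) +
      ∑ β ∈ (coverRoots b w).erase α, P.pairing α β *
        integralHom b (schubert b (w * refl P β) * schubert b v * schubert b (u * refl P α)) := by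
  have h1 := integralHom_eq_zero_of_reflHom_eq hα
    -- The combination is chosen so that all terms in c and c² cancel after reflection.
    (p := schubert b w * schubert b (v * refl P α) * schubert b (u * refl P α) -
      schubert b (w * refl P α) * schubert b (v * refl P α) * schubert b u +
      schubert b (w * refl P α) * schubert b v * schubert b (u * refl P α) +
      chernClass b α * schubert b w * (schubert b v * schubert b (u * refl P α))) (by
    simp only [map_add, map_sub, map_mul, reflHom_schubert hα hu, reflHom_schubert hα hv,
      reflHom_schubert hα hw, reflHom_schubert_mul hα hu, reflHom_schubert_mul hα hv,
      reflHom_schubert_mul hα hw, reflHom_chernClass]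
    ring)
  rw [map_add, map_add, map_sub, integralHom_chernClass_mul,
    ← Finset.add_sum_erase _ _ (simple_mem_coverRoots hα hw), P.pairing_same] at h1
  simp only [← mul_assoc] at h1
  linear_combination h1

lemma intersectionNumber_eq (w v u : P.weylGroup) :
    intersectionNumber b w v u = integralHom b (schubert b w * schubert b v * schubert b u) := rfl

lemma intersectionNumber_eq_zero {w v u : P.weylGroup}
    (h : length b w + length b v + length b u ≠ flagDim b) : intersectionNumber b w v u = 0 := by
  rw [intersectionNumber_eq]
  refine integralHom_eq_zero_of_isHomogeneous (fun x ↦ ?_) (length_longest (b := b) ▸ h)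
  exact ((isHomogeneous_schubertClass w x).mul (isHomogeneous_schubertClass v x)).mul
    (isHomogeneous_schubertClass u x)

open scoped Classical in
-- This avoids proving that every Bruhat cover raises the length by exactly one: a cover with
-- another length difference would contribute 0 for degree reasons.
lemma finsum_pairing_mul_intersectionNumber {w v u : P.weylGroup} {α : ι} (hα : α ∈ b.support)
    (h : length b w + length b v + length b u + 1 = flagDim b) :
    ∑ᶠ (β : ι) (_ : b.IsPos β ∧ BruhatCovers b (w * refl P β) w ∧ w * refl P β ≠ w * refl P α),
      P.pairing α β * intersectionNumber b (w * refl P β) v u =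
    ∑ β ∈ (coverRoots b w).erase α,
      P.pairing α β * intersectionNumber b (w * refl P β) v u := by
  refine finsum_mem_eq_sum_of_inter_support_eq _
    (s := {β | b.IsPos β ∧ BruhatCovers b (w * refl P β) w ∧ w * refl P β ≠ w * refl P α}) ?_
  have hα' := RootPairing.Base.isPos_of_mem_support hα
  ext β
  simp only [Set.mem_inter_iff, Set.mem_ofPred_eq, Finset.mem_coe, Finset.mem_erase,
    mem_coverRoots, Function.mem_support]
  refine and_congr_left fun hne ↦ ⟨fun ⟨h1, _, h3⟩ ↦ ⟨?_, h1, ?_⟩,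
    fun ⟨h1, h2, h3⟩ ↦ ⟨h2, bruhatCovers_of_length_eq h3, ?_⟩⟩
  · rintro rfl
    exact h3 rfl
  · by_contra h4
    exact hne (by rw [intersectionNumber_eq_zero (by omega), mul_zero])
  · exact fun h4 ↦ h1 (eq_of_refl_eq b h2 hα' (mul_left_cancel h4))

end Recurrence

end FlagSchubert

end

open FlagSchubert in
theorem mainTheorem4 {ι X Y : Type*} [Finite ι] [AddCommGroup X] [AddCommGroup Y]
    [Module.Finite ℤ X] [Module.Finite ℤ Y]
    (P : RootDatum ι X Y) [P.IsReduced] (b : P.Base) :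
    -- the Schubert classes exist, are unique, and form a basis of `H_T^*(G/B)` over `H_T^*(pt)`
    (∀ w : P.weylGroup, ∃! p, IsSchubertClass b w p) ∧
    (∀ p ∈ equivariantCohomology b,
      ∃! c : P.weylGroup → BaseRing b, p = ∑ᶠ w, c w • schubertClass b w) ∧
    -- the recurrence
    ∀ u v w : P.weylGroup, ∀ α ∈ b.support,
      let r := refl P α
      let c := intersectionNumber b
      length b u + length b v + length b w + 2 = flagDim b →
      BruhatLT b u (u * r) → BruhatLT b v (v * r) → BruhatLT b w (w * r) →
      c w (v * r) (u * r) = c (w * r) (v * r) u + c (w * r) v (u * r) +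
        ∑ᶠ (β : ι) (_ : b.IsPos β ∧ BruhatCovers b (w * refl P β) w ∧
            w * refl P β ≠ w * r),
          P.pairing α β * c (w * refl P β) v (u * r) := by
  classical
  refine ⟨fun w ↦ ⟨_, isSchubertClass_schubertClass w,
    fun p hp ↦ hp.unique (isSchubertClass_schubertClass w)⟩, fun p hp ↦ ?_, ?_⟩
  · obtain ⟨c, rfl⟩ := exists_eq_finsum_schubertClass hp
    exact ⟨c, rfl, fun c' hc' ↦ (finsum_smul_schubertClass_injective hc').symm⟩
  · intro u v w α hα r c hl hu hv hw
    have hα' := RootPairing.Base.isPos_of_mem_support hα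
    rw [bruhatLT_mul_refl_iff, lt_length_mul_refl_iff hα'] at hu hv hw
    have hlu := length_mul_simple hα hu
    simp only [r, c]
    rw [finsum_pairing_mul_intersectionNumber hα (by omega)]
    exact integralHom_recurrence hα hu hv hw
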